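/- **Conventions.** A simplicial complex $\Delta$ on a finite vertex set $V$ is a family of subsets of $V$ (its faces) closed under taking subsets. Its facets are the maximal faces, and its minimal non-faces are the minimal subsets of $V$ that are not faces. The Alexander dual is $\Delta^\vee=\{F\subseteq V: V\setminus F\notin\Delta\}$. A *strong gcd-order* of $\Delta$ is an ordering $M_1,\dots,M_r$ (without repetition) of all minimal non-faces of $\Delta$ such that whenever $1\le i<j\le r$ and $M_i\cap M_j=\emptyset$, there is a $k$ with $i<k\neq j$ and $M_k\subseteq M_i\cup M_j$; $\Delta$ satisfies the *strong gcd-condition* if such an order exists. $\Delta$ is *shellable* (in the non-pure sense) if its facets can be ordered $F_1,\dots,F_r$ so that for every $2\le i\le r$ the complex $\langle F_i\rangle\cap\langle F_1,\dots,F_{i-1}\rangle$ is pure of dimension $\dim F_i-1$, where $\langle\cdot\rangle$ denotes the complex of all subsets of the given sets. For a field $k$, $\Delta$ is *Cohen–Macaulay*, respectively *sequentially Cohen–Macaulay*, over $k$ if the standard graded Stanley–Reisner ring $k[\Delta]=k[x_v:v\in V]/\bigl(\prod_{v\in F}x_v : F\notin\Delta\bigr)$ is so as a graded module over itself. Here a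 finitely generated graded module $M$ is Cohen–Macaulay if there is an $M$-regular sequence of homogeneous elements of positive degree whose length is $\dim M$, and sequentially Cohen–Macaulay if there is a filtration $0=M_0\subsetneq M_1\subsetneq\dots\subsetneq M_r=M$ by graded submodules such that each $M_i/M_{i-1}$ is Cohen–Macaulay and $\dim(M_1/M_0)<\dots<\dim(M_r/M_{r-1})$. **Example.** There is exactly one simplicial complex $\Delta_1$ on $\{1,\dots,6\}$ whose minimal non-faces are precisely $\{1,2,3\}$, $\{1,2,6\}$, $\{4,5,6\}$; every $\{v\}$ with $1\le v\le 6$ is a face of $\Delta_1$. Moreover: 1. The order $\{1,2,3\},\{1,2,6\},\{4,5,6\}$ is a strong gcd-order of $\Delta_1$. 2. The facets of $\Delta_1^\vee$ are $\{1,2,3\},\{3,4,5\},\{4,5,6\}$. The link of the vertex $3$ in $\Delta_1^\vee$ is one-dimensional and not connected. 3. For every field $k$, $\Delta_1^\vee$ is not Cohen–Macaulay over $k$, and it is not sequentially Cohen–Macaulay over $k$. 4. $\Delta_1^\vee$ is not shellable. Consequently, for a finite simplicial complex $\Delta$ all of whose vertices are faces, the strong gcd-condition does not imply that $\Delta^\vee$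 is sequentially Cohen–Macaulay (over any given field), nor that $\Delta^\vee$ is shellable. -/

import Mathlib

/-! ### Simplicial complexes -/

/-- A simplicial complex on the vertex set `V`: a family of finite subsets of `V` closed under
taking subsets.  The empty face belongs to every complex that has a face at all.  The void complex
and complexes with ghost vertices are allowed, since both can occur as Alexander duals; absence of
ghost vertices is the separate predicate `NoGhostVertices`. -/
@[ext]
structure SimpComplex (V : Type*) where
  faces : Set (Finset V)
  down_closed : ∀ ⦃F G : Finset V⦄, F ∈ faces → G ⊆ F → G ∈ faces

namespace SimpComplex

variable {V : Type*}

/-- Every `{v}` with `v ∈ V` is a face. -/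
def NoGhostVertices (Δ : SimpComplex V) : Prop := ∀ v : V, {v} ∈ Δ.faces

/-- A facet is an inclusion-maximal face. -/
def IsFacet (Δ : SimpComplex V) (F : Finset V) : Prop := Maximal (fun G => G ∈ Δ.faces) F

/-- A minimal non-face is an inclusion-minimal subset of `V` that is not a face. -/
def IsMinimalNonface (Δ : SimpComplex V) (M : Finset V) : Prop := Minimal (fun G => G ∉ Δ.faces) M

/-- The Alexander dual: the subsets of `V` whose complement is not a face. -/
def alexanderDual [Fintype V] [DecidableEq V] (Δ : SimpComplex V) : SimpComplex V where
  faces := {F | Fᶜ ∉ Δ.faces}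
  down_closed := fun _ _ hF hGF h => hF (Δ.down_closed h (Finset.compl_subset_compl.mpr hGF))

/-- The complex generated by a family of sets: all subsets of members of the family. -/
def generatedBy (S : Set (Finset V)) : SimpComplex V where
  faces := {F | ∃ G ∈ S, F ⊆ G}
  down_closed := fun _ _ hF hGF => hF.imp fun _ h => ⟨h.1, hGF.trans h.2⟩

/-- The largest complex in which no member of `S` is a face. -/
def avoiding (S : Set (Finset V)) : SimpComplex V where
  faces := {F | ∀ M ∈ S, ¬ M ⊆ F}
  down_closed := fun _ _ hF hGF M hM h => hF M hM (h.trans hGF)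

/-- The intersection of two complexes. -/
def inter (Δ Γ : SimpComplex V) : SimpComplex V where
  faces := Δ.faces ∩ Γ.faces
  down_closed := fun _ _ hF hGF => ⟨Δ.down_closed hF.1 hGF, Γ.down_closed hF.2 hGF⟩

/-- The link of `F`: all `G` disjoint from `F` with `G ∪ F` a face. -/
def link [DecidableEq V] (Δ : SimpComplex V) (F : Finset V) : SimpComplex V where
  faces := {G | Disjoint G F ∧ G ∪ F ∈ Δ.faces}
  down_closed := fun _ _ hG hHG =>
    ⟨hG.1.mono_left hHG, Δ.down_closed hG.2 (Finset.union_subset_union_left hHG)⟩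

/-- The dimension of a face, `|F| - 1`; it is `-1` for the empty face. -/
def faceDim (F : Finset V) : ℤ := (F.card : ℤ) - 1

/-- `Δ` has dimension `d`: the largest dimension of a face is `d`. -/
def HasDim (Δ : SimpComplex V) (d : ℤ) : Prop := IsGreatest (faceDim '' Δ.faces) d

/-- `Δ` is pure of dimension `d`: it is not void and all its facets have dimension `d`. -/
def IsPureOfDim (Δ : SimpComplex V) (d : ℤ) : Prop :=
  Δ.faces.Nonempty ∧ ∀ F, Δ.IsFacet F → faceDim F = d

/-- The graph of vertices and edges of `Δ`. -/
def edgeGraph [DecidableEq V] (Δ : SimpComplex V) : SimpleGraph {v : V // {v} ∈ Δ.faces} where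
  Adj u v := u ≠ v ∧ ({u.1, v.1} : Finset V) ∈ Δ.faces
  symm := ⟨fun u v h => ⟨h.1.symm, by rw [Finset.pair_comm]; exact h.2⟩⟩
  loopless := ⟨fun _ h => h.1 rfl⟩

/-- A complex is connected if its graph of vertices and edges is connected (for a complex this is
the same as connectedness of the geometric realization). -/
def IsConnected [DecidableEq V] (Δ : SimpComplex V) : Prop := Δ.edgeGraph.Connected

/-! ### Shellability and the strong gcd-condition -/

/-- `L = [F₁, …, F_r]` lists the facets of `Δ` without repetition, and for `i ≥ 2` the complex
`⟨F_i⟩ ∩ ⟨F₁, …, F_{i-1}⟩` is pure of dimension `dim F_i - 1`. -/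
def IsShellingOrder (Δ : SimpComplex V) (L : List (Finset V)) : Prop :=
  L.Nodup ∧ (∀ F, F ∈ L ↔ Δ.IsFacet F) ∧
    ∀ i : Fin L.length, 0 < i.val →
      ((generatedBy {L[i]}).inter
        (generatedBy {F | ∃ j : Fin L.length, j < i ∧ L[j] = F})).IsPureOfDim (faceDim L[i] - 1)

/-- (Non-pure) shellability. -/
def IsShellable (Δ : SimpComplex V) : Prop := ∃ L, Δ.IsShellingOrder L

/-- `L = [M₁, …, M_r]` lists the minimal non-faces of `Δ` without repetition, and whenever `i < j`
and `M_i ∩ M_j = ∅` there is `k` with `i < k ≠ j` and `M_k ⊆ M_i ∪ M_j`. -/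
def IsStrongGcdOrder [DecidableEq V] (Δ : SimpComplex V) (L : List (Finset V)) : Prop :=
  L.Nodup ∧ (∀ M, M ∈ L ↔ Δ.IsMinimalNonface M) ∧
    ∀ i j : Fin L.length, i < j → L[i] ∩ L[j] = ∅ →
      ∃ k : Fin L.length, i < k ∧ k ≠ j ∧ L[k] ⊆ L[i] ∪ L[j]

/-- The strong gcd-condition. -/
def StrongGcd [DecidableEq V] (Δ : SimpComplex V) : Prop := ∃ L, Δ.IsStrongGcdOrder L

end SimpComplex

/-! ### Graded Cohen–Macaulay and sequentially Cohen–Macaulay modules -/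

section Graded

variable {k A : Type*} [Field k] [CommRing A] [Algebra k A]

/-- For a finitely generated graded module `M` over the `ℕ`-graded `k`-algebra `A = ⨁ 𝒜 d`: `M` is
Cohen–Macaulay, i.e. its depth equals its Krull dimension, if there is an `M`-regular sequence of
homogeneous elements of positive degree whose length is the dimension of `M`. -/
def IsGradedCohenMacaulay (𝒜 : ℕ → Submodule k A) [GradedAlgebra 𝒜]
    (M : Type*) [AddCommGroup M] [Module A M] : Prop :=
  ∃ rs : List A, (∀ r ∈ rs, ∃ d : ℕ, 0 < d ∧ r ∈ 𝒜 d) ∧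
    RingTheory.Sequence.IsRegular M rs ∧
    ((rs.length : ℕ∞) : WithBot ℕ∞) = Module.supportDim A M

/-- The quotient `N' / N` of two submodules `N ≤ N'` of `M`. -/
abbrev SubQuotient {M : Type*} [AddCommGroup M] [Module A M] (N' N : Submodule A M) : Type _ :=
  ↥N' ⧸ N.submoduleOf N'

/-- Stanley's definition: a finitely generated graded module `M = ⨁ ℳ i` over `A = ⨁ 𝒜 d` is
sequentially Cohen–Macaulay if it has a finite filtration `0 = M₀ ⊂ M₁ ⊂ ⋯ ⊂ M_r = M` by graded
submodules such that every `M_i / M_{i-1}` is Cohen–Macaulay and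
`dim (M₁ / M₀) < dim (M₂ / M₁) < ⋯ < dim (M_r / M_{r-1})`. -/
def IsGradedSequentiallyCohenMacaulay (𝒜 : ℕ → Submodule k A) [GradedAlgebra 𝒜]
    {M : Type*} [AddCommGroup M] [Module k M] [Module A M] [IsScalarTower k A M] [Module.Finite A M]
    {ι : Type*} [DecidableEq ι] [VAdd ℕ ι] (ℳ : ι → Submodule k M) [DirectSum.Decomposition ℳ]
    [SetLike.GradedSMul 𝒜 ℳ] : Prop :=
  ∃ (r : ℕ) (N : Fin (r + 1) → Submodule A M),
    N 0 = ⊥ ∧ N (Fin.last r) = ⊤ ∧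
    (∀ i, (N i).IsHomogeneous ℳ) ∧
    (∀ i : Fin r, N i.castSucc < N i.succ) ∧
    (∀ i : Fin r, IsGradedCohenMacaulay 𝒜 (SubQuotient (N i.succ) (N i.castSucc))) ∧
    (∀ i j : Fin r, i < j →
      Module.supportDim A (SubQuotient (N i.succ) (N i.castSucc)) <
        Module.supportDim A (SubQuotient (N j.succ) (N j.castSucc)))

/-- The grading induced on the quotient of a graded algebra by an ideal: the images of the
graded pieces. -/
def quotientGrading (𝒜 : ℕ → Submodule k A) (I : Ideal A) (d : ℕ) : Submodule k (A ⧸ I) :=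
  (𝒜 d).map (Ideal.Quotient.mkₐ k I).toLinearMap

theorem isInternal_quotientGrading (𝒜 : ℕ → Submodule k A) [GradedAlgebra 𝒜] (I : Ideal A)
    (hI : I.IsHomogeneous 𝒜) : DirectSum.IsInternal (quotientGrading 𝒜 I) := by
  let f : ∀ d, 𝒜 d →ₗ[k] quotientGrading 𝒜 I d := fun d =>
    (Ideal.Quotient.mkₐ k I).toLinearMap.restrict (p := 𝒜 d) (q := quotientGrading 𝒜 I d)
      fun _ hx => Submodule.mem_map_of_mem hx
  have hf : ∀ d, Function.Surjective (f d) := by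
    rintro d ⟨_, a, ha, rfl⟩
    exact ⟨⟨a, ha⟩, rfl⟩
  have hπ : Function.Surjective (DirectSum.lmap f) := (DirectSum.lmap_surjective f).2 hf
  have hc : ∀ y, DirectSum.coeAddMonoidHom (quotientGrading 𝒜 I) (DirectSum.lmap f y) =
      Ideal.Quotient.mk I ((DirectSum.decompose 𝒜).symm y) := by
    intro y
    induction y using DirectSum.induction_on with
    | zero => simp
    | of d a =>
      rw [DirectSum.decompose_symm_of, ← DirectSum.lof_eq_of k, DirectSum.lmap_lof,
        DirectSum.lof_eq_of, DirectSum.coeAddMonoidHom_of]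
      rfl
    | add x y hx hy => rw [map_add, map_add, hx, hy, DirectSum.decompose_symm_add, map_add]
  constructor
  · rw [injective_iff_map_eq_zero]
    intro x hx
    obtain ⟨y, rfl⟩ := hπ x
    rw [hc, Ideal.Quotient.eq_zero_iff_mem] at hx
    ext d
    have h := hI d hx
    rw [Equiv.apply_symm_apply] at h
    rw [DirectSum.lmap_apply]
    exact Ideal.Quotient.eq_zero_iff_mem.2 h
  · intro x
    obtain ⟨a, rfl⟩ := Ideal.Quotient.mk_surjective x
    exact ⟨DirectSum.lmap f (DirectSum.decompose 𝒜 a), by rw [hc, Equiv.symm_apply_apply]⟩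

/-- The quotient of a graded algebra by a homogeneous ideal is a graded algebra. -/
@[reducible]
noncomputable def quotientGradedAlgebra (𝒜 : ℕ → Submodule k A) [GradedAlgebra 𝒜] (I : Ideal A)
    (hI : I.IsHomogeneous 𝒜) : GradedAlgebra (quotientGrading 𝒜 I) where
  one_mem := ⟨1, SetLike.GradedOne.one_mem, map_one (Ideal.Quotient.mk I)⟩
  mul_mem := by
    rintro i j _ _ ⟨a, ha, rfl⟩ ⟨b, hb, rfl⟩
    exact ⟨a * b, SetLike.GradedMul.mul_mem ha hb, map_mul (Ideal.Quotient.mk I) _ _⟩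
  toDecomposition := (isInternal_quotientGrading 𝒜 I hI).chooseDecomposition

end Graded

/-! ### The Stanley–Reisner ring -/

namespace SimpComplex

variable {V : Type*}

attribute [local instance] MvPolynomial.gradedAlgebra

/-- The Stanley–Reisner ideal, generated by the monomials `∏ i ∈ F, x_i` for the non-faces `F`. -/
noncomputable def stanleyReisnerIdeal (k : Type*) [Field k] (Δ : SimpComplex V) : Ideal (MvPolynomial V k) :=
  Ideal.span {p | ∃ F : Finset V, F ∉ Δ.faces ∧ p = ∏ i ∈ F, MvPolynomial.X i}

theorem stanleyReisnerIdeal_isHomogeneous (k : Type*) [Field k] (Δ : SimpComplex V) :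
    (Δ.stanleyReisnerIdeal k).IsHomogeneous (MvPolynomial.homogeneousSubmodule V k) := by
  refine Ideal.homogeneous_span _ _ ?_
  rintro _ ⟨F, -, rfl⟩
  exact ⟨∑ _i ∈ F, 1, MvPolynomial.IsHomogeneous.prod F _ _ fun i _ =>
    MvPolynomial.isHomogeneous_X k i⟩

/-- The Stanley–Reisner ring `k[Δ]`. -/
abbrev StanleyReisnerRing (k : Type*) [Field k] (Δ : SimpComplex V) : Type _ :=
  MvPolynomial V k ⧸ Δ.stanleyReisnerIdeal k

/-- The standard grading of `k[Δ]`, in which every variable has degree one. -/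
noncomputable def stanleyReisnerGrading (k : Type*) [Field k] (Δ : SimpComplex V) :
    ℕ → Submodule k (Δ.StanleyReisnerRing k) :=
  quotientGrading (MvPolynomial.homogeneousSubmodule V k) (Δ.stanleyReisnerIdeal k)

noncomputable instance stanleyReisnerGradedAlgebra (k : Type*) [Field k] (Δ : SimpComplex V) :
    GradedAlgebra (Δ.stanleyReisnerGrading k) :=
  quotientGradedAlgebra _ _ (Δ.stanleyReisnerIdeal_isHomogeneous k)

/-- `Δ` is Cohen–Macaulay over `k` if `k[Δ]` is. -/
def IsCohenMacaulay (k : Type*) [Field k] (Δ : SimpComplex V) : Prop :=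
  IsGradedCohenMacaulay (Δ.stanleyReisnerGrading k) (Δ.StanleyReisnerRing k)

/-- `Δ` is sequentially Cohen–Macaulay over `k` if `k[Δ]`, as a graded module over itself, is. -/
def IsSequentiallyCohenMacaulay (k : Type*) [Field k] (Δ : SimpComplex V) : Prop :=
  IsGradedSequentiallyCohenMacaulay (Δ.stanleyReisnerGrading k) (Δ.stanleyReisnerGrading k)

end SimpComplex

/-- The complex `Δ₁` of the example: the complex on six vertices whose faces are the sets that
contain none of `{1,2,3}`, `{1,2,6}`, `{4,5,6}`.  The vertex `i ∈ {1,…,6}` is `i - 1 : Fin 6`. -/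
def exampleComplex : SimpComplex (Fin 6) :=
  SimpComplex.avoiding {{0, 1, 2}, {0, 1, 5}, {3, 4, 5}}

/-! With vertices numbered from 0, the dual has facets 012, 234, 345. The algebraic failure comes
from a clash between dimension 3 and depth 2 of its Stanley–Reisner ring R. Every nonzero ideal of R
has dimension at least 3, because an element nonzero on a facet F generates a module whose support
contains the whole coordinate space of F (`le_supportDim_of_ne_bot`). In a sequentially
Cohen–Macaulay filtration the first quotient is such an ideal and the dimensions increase, so every
quotient has a homogeneous regular sequence of length at least 3. With N = R/(all variables), this
makes Ext^i(N, –) vanish for i < 3 on each quotient, hence on R by the long exact sequence. The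
Cohen–Macaulay case needs no filtration. On the other hand x₀ + x₃, x₂ + x₅ is a regular sequence on
R, and modulo it x₀ is a nonzero class killed by every variable. So Hom(N, R/(x₀ + x₃, x₂ + x₅)) ≠
0, whereas dimension shifting (`ExtVanishesBelow.mem_span_pair`) would make it zero. Shellability
fails because 012 meets each other facet in at most one vertex. The remaining claims are finite
checks. -/

/-! ### Vanishing of `Ext` below the length of a regular sequence -/

section ExtVanishing

open CategoryTheory CategoryTheory.Abelian RingTheory.Sequence
open scoped Pointwise

universe u

variable {R : Type u} [CommRing R]

/-- `Ext^i(N, M)` vanishes for `i < n`. -/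
def ExtVanishesBelow (N M : Type u) [AddCommGroup N] [Module R N] [AddCommGroup M] [Module R M]
    (n : ℕ) : Prop :=
  ∀ i < n, Subsingleton (Ext (ModuleCat.of R N) (ModuleCat.of R M) i)

variable {N M M' M'' : Type u} [AddCommGroup N] [Module R N] [AddCommGroup M] [Module R M]
  [AddCommGroup M'] [Module R M'] [AddCommGroup M''] [Module R M'']

/-- If a weakly `M`-regular sequence annihilates `N`, then `Ext^i(N, M)` vanishes below its
length. -/
theorem RingTheory.Sequence.IsWeaklyRegular.extVanishesBelow {rs : List R}
    (h : IsWeaklyRegular M rs) (hN : ∀ r ∈ rs, r ∈ Module.annihilator R N) :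
    ExtVanishesBelow (R := R) N M rs.length := by
  induction rs generalizing M with
  | nil => intro i hi; simp at hi
  | cons a rs ih =>
    rw [isWeaklyRegular_cons_iff] at h
    have hr := ih h.2 fun r hr => hN r (List.mem_cons_of_mem _ hr)
    have ha := hN a List.mem_cons_self
    intro i hi
    rcases i with _ | i
    · have : Subsingleton (N →ₗ[R] M) :=
        ⟨fun f g => LinearMap.ext fun x => h.1 <| by
          simp only [← map_smul, Module.mem_annihilator.mp ha x, map_zero]⟩
      exact (Ext.addEquiv₀.trans ModuleCat.homAddEquiv).subsingleton
    -- Multiplication by `a` on Ext^(i+1)(N, M) is injective because Ext^i(N, M/aM) = 0, and zero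
    -- because `a` kills N; so the group is zero.
    · have hmono := (Ext.covariant_sequence_exact₁' (ModuleCat.of R N)
        (IsSMulRegular.smulShortComplex_shortExact (M := ModuleCat.of R M) h.1) i (i + 1) rfl).mono_g
        ((AddCommGrpCat.isZero_of_iff_subsingleton.mpr
          (hr i (by simpa using hi))).eq_zero_of_src _)
      have hzero := Ext.postcomp_smul_id_eq_zero_of_mem_annihilator (M := ModuleCat.of R M)
        (N := ModuleCat.of R N) ha (i + 1)
      exact AddCommGrpCat.subsingleton_of_isZero
        (@Limits.IsZero.of_mono_eq_zero _ _ _ _ _ _ hmono hzero)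

/-- Dimension shifting: Ext^i(N, M/aM) sits between Ext^i(N, M) and Ext^(i+1)(N, M), so one degree
is lost. -/
theorem ExtVanishesBelow.quotSMulTop {n : ℕ} (h : ExtVanishesBelow (R := R) N M (n + 1)) {a : R}
    (ha : IsSMulRegular M a) : ExtVanishesBelow (R := R) N (QuotSMulTop a M) n := by
  intro i hi
  exact AddCommGrpCat.subsingleton_of_isZero <| ShortComplex.Exact.isZero_of_both_zeros
    (Ext.covariant_sequence_exact₃' (ModuleCat.of R N)
      (IsSMulRegular.smulShortComplex_shortExact (M := ModuleCat.of R M) ha) i (i + 1) rfl)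
    ((AddCommGrpCat.isZero_of_iff_subsingleton.mpr (h i (by lia))).eq_zero_of_src _)
    ((AddCommGrpCat.isZero_of_iff_subsingleton.mpr (h (i + 1) (by lia))).eq_zero_of_tgt _)

theorem ExtVanishesBelow.subsingleton_linearMap {n : ℕ} (h : ExtVanishesBelow (R := R) N M (n + 1)) :
    Subsingleton (N →ₗ[R] M) :=
  have := h 0 n.succ_pos
  have : Subsingleton (ModuleCat.of R N ⟶ ModuleCat.of R M) := Ext.addEquiv₀.symm.subsingleton
  (ModuleCat.homAddEquiv (M := ModuleCat.of R N) (N := ModuleCat.of R M)).symm.subsingleton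

theorem ExtVanishesBelow.of_subsingleton [Subsingleton M] (n : ℕ) :
    ExtVanishesBelow (R := R) N M n := fun i _ => by
  have h0 : 𝟙 (ModuleCat.of R M) = 0 :=
    (ModuleCat.isZero_of_subsingleton (ModuleCat.of R M)).eq_of_src _ _
  refine ⟨fun x y => ?_⟩
  rw [← x.comp_mk₀_id, ← y.comp_mk₀_id, h0]
  simp

theorem ExtVanishesBelow.of_exact {n : ℕ} {f : M' →ₗ[R] M} {g : M →ₗ[R] M''}
    (hf : Function.Injective f) (hg : Function.Surjective g) (hfg : Function.Exact f g)
    (h' : ExtVanishesBelow (R := R) N M' n) (h'' : ExtVanishesBelow (R := R) N M'' n) :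
    ExtVanishesBelow (R := R) N M n := by
  intro i hi
  let S := ModuleCat.shortComplexOfCompEqZero f g hfg.linearMap_comp_eq_zero
  have hS : S.ShortExact :=
    { exact := ModuleCat.shortComplex_exact S hfg
      mono_f := (ModuleCat.mono_iff_injective _).mpr hf
      epi_g := (ModuleCat.epi_iff_surjective _).mpr hg }
  exact AddCommGrpCat.subsingleton_of_isZero <| ShortComplex.Exact.isZero_of_both_zeros
    (Ext.covariant_sequence_exact₂' (ModuleCat.of R N) hS i)
    ((AddCommGrpCat.isZero_of_iff_subsingleton.mpr (h' i hi)).eq_zero_of_src _)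
    ((AddCommGrpCat.isZero_of_iff_subsingleton.mpr (h'' i hi)).eq_zero_of_tgt _)

theorem ExtVanishesBelow.of_subQuotient {n : ℕ} {P Q : Submodule R M} (hPQ : P ≤ Q)
    (hP : ExtVanishesBelow (R := R) N P n)
    (hQ : ExtVanishesBelow (R := R) N (SubQuotient Q P) n) :
    ExtVanishesBelow (R := R) N Q n := by
  refine hP.of_exact (f := Submodule.inclusion hPQ) (g := (P.submoduleOf Q).mkQ)
    (Submodule.inclusion_injective hPQ) (Submodule.mkQ_surjective _) ?_ hQ
  rw [LinearMap.exact_iff, Submodule.ker_mkQ, Submodule.range_inclusion]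
  rfl

theorem ExtVanishesBelow.mono {m n : ℕ} (h : ExtVanishesBelow (R := R) N M n) (hmn : m ≤ n) :
    ExtVanishesBelow (R := R) N M m := fun i hi => h i (hi.trans_le hmn)

/-- If `a, b` is a weakly regular sequence and `Ext^i(R ⧸ I, R) = 0` for `i ≤ 2`, then no nonzero
element of `R ⧸ (a, b)` is annihilated by `I`. -/
theorem ExtVanishesBelow.mem_span_pair {I : Ideal R} (h : ExtVanishesBelow (R := R) (R ⧸ I) R 3)
    {a b s : R} (ha : ∀ x, a * x = 0 → x = 0) (hb : ∀ x y, b * x = a * y → ∃ z, x = a * z)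
    (hs : ∀ r ∈ I, r * s ∈ Ideal.span {a, b}) : s ∈ Ideal.span {a, b} := by
  have hb' : IsSMulRegular (QuotSMulTop a R) b := by
    refine (isSMulRegular_quotient_iff_mem_of_smul_mem _ _).mpr fun x hx => ?_
    rw [Submodule.mem_smul_pointwise_iff_exists] at hx ⊢
    obtain ⟨y, -, hy⟩ := hx
    obtain ⟨z, hz⟩ := hb x y hy.symm
    exact ⟨z, trivial, hz.symm⟩
  -- Two shifts lower the bound from 3 to 1, which leaves Hom(R/I, R/(a, b)) = 0.
  have hsub := ((h.quotSMulTop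
    (isSMulRegular_iff_right_eq_zero_of_smul.mpr ha)).quotSMulTop hb').subsingleton_linearMap
  let τ : R →ₗ[R] QuotSMulTop b (QuotSMulTop a R) := (Submodule.mkQ _).comp (Submodule.mkQ _)
  have hτ (x : R) : τ x = 0 ↔ x ∈ Ideal.span {a, b} := by
    rw [Ideal.mem_span_pair, LinearMap.comp_apply, Submodule.mkQ_apply,
      Submodule.Quotient.mk_eq_zero, Submodule.mem_smul_pointwise_iff_exists]
    constructor
    · rintro ⟨y, -, hy⟩
      obtain ⟨g, rfl⟩ := Submodule.mkQ_surjective _ y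
      rw [← map_smul, Submodule.mkQ_apply, Submodule.mkQ_apply, eq_comm, Submodule.Quotient.eq,
        Submodule.mem_smul_pointwise_iff_exists] at hy
      obtain ⟨f, -, hf⟩ := hy
      simp only [smul_eq_mul] at hf
      exact ⟨f, g, by linear_combination hf⟩
    · rintro ⟨f, g, rfl⟩
      refine ⟨Submodule.mkQ _ g, trivial, ?_⟩
      rw [← map_smul, Submodule.mkQ_apply, Submodule.mkQ_apply, eq_comm, Submodule.Quotient.eq,
        Submodule.mem_smul_pointwise_iff_exists]
      exact ⟨f, trivial, by simp only [smul_eq_mul]; ring⟩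
  -- Multiplication by `s` into R/(a, b) kills I, so it factors through R/I and must vanish;
  -- evaluate at 1.
  let σ := τ.comp (LinearMap.toSpanSingleton R R s)
  have hσ : I ≤ LinearMap.ker σ := fun r hr => (hτ (r * s)).mpr (hs r hr)
  have hσ1 : τ (1 * s) = 0 :=
    congrArg (fun f => f (Ideal.Quotient.mk I 1)) (hsub.elim (Submodule.liftQ I σ hσ) 0)
  rwa [one_mul, hτ] at hσ1

variable {k : Type*} [Field k] [Algebra k R]

/-- The regular sequence witnessing the property has positive-degree members, which annihilate N,
and its length is the dimension of M. -/
theorem IsGradedCohenMacaulay.extVanishesBelow {𝒜 : ℕ → Submodule k R} [GradedAlgebra 𝒜]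
    (h : IsGradedCohenMacaulay 𝒜 M) {n : ℕ} (hn : n ≤ Module.supportDim R M)
    (hN : ∀ d, 0 < d → ∀ r ∈ 𝒜 d, r ∈ Module.annihilator R N) :
    ExtVanishesBelow (R := R) N M n := by
  obtain ⟨rs, hrs, hreg, hlen⟩ := h
  refine (hreg.toIsWeaklyRegular.extVanishesBelow fun r hr => ?_).mono ?_
  · obtain ⟨d, hd, hrd⟩ := hrs r hr
    exact hN d hd r hrd
  · rw [← hlen] at hn
    exact_mod_cast hn

/-- If every nonzero submodule of a sequentially Cohen–Macaulay module has dimension at least `n`,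
then `Ext^i(N, M)` vanishes for `i < n` and every `N` annihilated by the irrelevant ideal. -/
theorem IsGradedSequentiallyCohenMacaulay.extVanishesBelow {𝒜 : ℕ → Submodule k R}
    [GradedAlgebra 𝒜] [Module k M] [IsScalarTower k R M] [Module.Finite R M]
    {ι : Type*} [DecidableEq ι] [VAdd ℕ ι] {ℳ : ι → Submodule k M} [DirectSum.Decomposition ℳ]
    [SetLike.GradedSMul 𝒜 ℳ] (h : IsGradedSequentiallyCohenMacaulay 𝒜 ℳ) {n : ℕ}
    (hn : ∀ P : Submodule R M, P ≠ ⊥ → n ≤ Module.supportDim R P)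
    (hN : ∀ d, 0 < d → ∀ r ∈ 𝒜 d, r ∈ Module.annihilator R N) :
    ExtVanishesBelow (R := R) N (⊤ : Submodule R M) n := by
  obtain ⟨r, P, h0, h1, -, hlt, hCM, hdim⟩ := h
  -- The bottom quotient is itself a nonzero submodule of M; strict growth of dimensions carries its
  -- bound to all later quotients.
  have hfirst (i : Fin r) (hi : P i.castSucc = ⊥) :
      n ≤ Module.supportDim R (SubQuotient (P i.succ) (P i.castSucc)) := by
    rw [Module.supportDim_eq_of_equiv (Submodule.quotEquivOfEqBot _ (by
      rw [hi, Submodule.submoduleOf, Submodule.comap_bot, Submodule.ker_subtype]))]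
    exact hn _ (bot_le.trans_lt (hlt i)).ne'
  have hge (i : Fin r) : n ≤ Module.supportDim R (SubQuotient (P i.succ) (P i.castSucc)) := by
    let z : Fin r := ⟨0, i.pos⟩
    have hz := hfirst z h0
    rcases (show z ≤ i from Nat.zero_le _).eq_or_lt with h | h
    · exact h ▸ hz
    · exact hz.trans (hdim z i h).le
  rw [← h1]
  refine Fin.induction (motive := fun i => ExtVanishesBelow (R := R) N (P i) n) ?_ ?_ (Fin.last r)
  · rw [h0]
    exact .of_subsingleton n
  · exact fun i hi => .of_subQuotient (hlt i).le hi ((hCM i).extVanishesBelow (hge i) hN)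

end ExtVanishing

/-! ### Stanley–Reisner rings and restriction to faces -/

section SupportDim

/-- A lower bound for the dimension of a module from an element whose annihilator is contained in
the kernel of a surjection onto a domain. -/
theorem ringKrullDim_le_supportDim {A B M : Type*} [CommRing A] [CommRing B] [IsDomain B]
    [AddCommGroup M] [Module A M] (φ : A →+* B) (hφ : Function.Surjective φ) (m : M)
    (hm : ∀ r : A, r • m = 0 → φ r = 0) : ringKrullDim B ≤ Module.supportDim A M := by
  rw [← ringKrullDim_eq_of_ringEquiv (RingHom.quotientKerEquivOfSurjective hφ),
    ringKrullDim_quotient]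
  -- A prime containing ker φ contains the annihilator of `m`, hence lies in the support.
  refine Order.krullDim_le_of_strictMono (fun p => ⟨p.1, ?_⟩) fun _ _ h => h
  refine Module.mem_support_iff_exists_annihilator.mpr ⟨m, fun r hr => p.2 ?_⟩
  exact hm r (Submodule.mem_annihilator_span_singleton _ _ |>.mp hr)

end SupportDim

namespace SimpComplex

open MvPolynomial

variable {V k : Type*} [Field k]

/-- The algebra endomorphism of `k[x_v : v ∈ V]` sending the variables outside `F` to `0`. -/
noncomputable def restrictVars (k : Type*) [Field k] (F : Finset V) :
    MvPolynomial V k →ₐ[k] MvPolynomial V k :=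
  (rename Subtype.val).comp (killCompl (Subtype.val_injective (p := (· ∈ F))))

theorem restrictVars_eq_zero_iff (F : Finset V) (p : MvPolynomial V k) :
    restrictVars k F p = 0 ↔ killCompl (Subtype.val_injective (p := (· ∈ F))) p = 0 :=
  rename_eq_zero_iff_of_injective _ Subtype.val_injective

@[simp]
theorem restrictVars_X [DecidableEq V] (F : Finset V) (i : V) :
    restrictVars k F (X i) = if i ∈ F then X i else 0 := by
  by_cases hi : i ∈ F
  · have h : killCompl (R := k) (Subtype.val_injective (p := (· ∈ F))) (X i) = X ⟨i, hi⟩ := by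
      rw [← killCompl_rename_app (Subtype.val_injective (p := (· ∈ F))) (X ⟨i, hi⟩), rename_X]
    simp [restrictVars, h, hi]
  · simp [restrictVars, killCompl, hi]

theorem restrictVars_restrictVars [DecidableEq V] (F G : Finset V) (p : MvPolynomial V k) :
    restrictVars k F (restrictVars k G p) = restrictVars k (F ∩ G) p := by
  rw [← AlgHom.comp_apply]
  congr 1
  ext1 i
  by_cases hF : i ∈ F <;> by_cases hG : i ∈ G <;> simp [hF, hG]

theorem coeff_eq_zero_of_restrictVars_eq_zero {F : Finset V} {p : MvPolynomial V k}
    (h : restrictVars k F p = 0) {m : V →₀ ℕ} (hm : m.support ⊆ F) : coeff m p = 0 := by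
  rw [restrictVars_eq_zero_iff] at h
  have hm' := Finsupp.mapDomain_comapDomain (Subtype.val : {i // i ∈ F} → V)
    Subtype.val_injective m (by simpa using hm)
  rw [← hm', ← coeff_killCompl Subtype.val_injective, h, coeff_zero]

/-- Membership in the Stanley–Reisner ideal is detected on the generating faces. -/
theorem mem_stanleyReisnerIdeal_generatedBy {S : Set (Finset V)} {p : MvPolynomial V k} :
    p ∈ (generatedBy S).stanleyReisnerIdeal k ↔ ∀ F ∈ S, restrictVars k F p = 0 := by
  classical
  constructor
  · intro hp F hF
    suffices (generatedBy S).stanleyReisnerIdeal k ≤ RingHom.ker (restrictVars k F) from this hp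
    refine Ideal.span_le.mpr ?_
    rintro _ ⟨G, hG, rfl⟩
    obtain ⟨i, hiG, hiF⟩ := Finset.not_subset.mp fun h => hG ⟨F, hF, h⟩
    rw [SetLike.mem_coe, RingHom.mem_ker, map_prod]
    exact Finset.prod_eq_zero hiG (by simp [hiF])
  · intro h
    -- A monomial of `p` supported in some F ∈ S would survive restriction to F; so every monomial
    -- has non-face support and is a multiple of a generator.
    rw [p.as_sum]
    refine Ideal.sum_mem _ fun m hm => ?_
    rw [monomial_eq]
    refine Ideal.mul_mem_left _ _ (Ideal.mem_of_dvd _ ?_ (Ideal.subset_span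
      ⟨m.support, ?_, rfl⟩))
    · exact Finset.prod_dvd_prod_of_dvd _ _ fun i hi =>
        dvd_pow_self _ (Finsupp.mem_support_iff.mp hi)
    · rintro ⟨F, hF, hmF⟩
      exact mem_support_iff.mp hm (coeff_eq_zero_of_restrictVars_eq_zero (h F hF) hmF)

/-- If all generating faces have at least `n` elements, every nonzero ideal of the
Stanley–Reisner ring has dimension at least `n`. -/
theorem le_supportDim_of_ne_bot {S : Set (Finset V)} {n : ℕ} (hS : ∀ F ∈ S, n ≤ F.card)
    {P : Submodule ((generatedBy S).StanleyReisnerRing k) ((generatedBy S).StanleyReisnerRing k)}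
    (hP : P ≠ ⊥) :
    n ≤ Module.supportDim ((generatedBy S).StanleyReisnerRing k) P := by
  obtain ⟨x, hxP, hx⟩ := P.ne_bot_iff.mp hP
  obtain ⟨p, rfl⟩ := Ideal.Quotient.mk_surjective x
  rw [ne_eq, Ideal.Quotient.eq_zero_iff_mem, mem_stanleyReisnerIdeal_generatedBy] at hx
  push Not at hx
  obtain ⟨F, hF, hpF⟩ := hx
  -- F is a face where `p` does not vanish. The polynomial ring on F is a domain quotient of
  -- dimension |F|, so whatever kills `p` maps to zero there.
  let κ := killCompl (R := k) (Subtype.val_injective (p := (· ∈ F)))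
  have hκ (q) (hq : q ∈ (generatedBy S).stanleyReisnerIdeal k) : κ q = 0 :=
    (restrictVars_eq_zero_iff F q).mp (mem_stanleyReisnerIdeal_generatedBy.mp hq F hF)
  let φ : (generatedBy S).StanleyReisnerRing k →+* MvPolynomial {i // i ∈ F} k :=
    Ideal.Quotient.lift _ κ.toRingHom hκ
  have hφ : Function.Surjective φ := fun q =>
    ⟨Ideal.Quotient.mk _ (rename Subtype.val q), killCompl_rename_app _ q⟩
  refine le_trans ?_ (ringKrullDim_le_supportDim φ hφ (⟨_, hxP⟩ : P) fun r hr => ?_)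
  · rw [MvPolynomial.ringKrullDim_of_isNoetherianRing, ringKrullDim_eq_zero_of_field, zero_add,
      Nat.card_eq_fintype_card, Fintype.card_coe]
    exact_mod_cast hS F hF
  · obtain ⟨q, rfl⟩ := Ideal.Quotient.mk_surjective r
    have h0 : φ (Ideal.Quotient.mk _ q * Ideal.Quotient.mk _ p) = 0 := by
      rw [← smul_eq_mul, show Ideal.Quotient.mk _ q • Ideal.Quotient.mk _ p = 0 from
        congrArg Subtype.val hr, map_zero]
    rw [map_mul] at h0
    exact (mul_eq_zero.mp h0).resolve_right ((restrictVars_eq_zero_iff F p).not.mp hpF)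

/-- Homogeneous elements of positive degree lie in the ideal generated by the variables. -/
theorem mem_map_idealOfVars_of_mem_grading {Δ : SimpComplex V} {d : ℕ} (hd : 0 < d)
    {r : Δ.StanleyReisnerRing k} (hr : r ∈ Δ.stanleyReisnerGrading k d) :
    r ∈ (idealOfVars V k).map (Ideal.Quotient.mk (Δ.stanleyReisnerIdeal k)) := by
  obtain ⟨p, hp, rfl⟩ := hr
  refine Ideal.mem_map_of_mem _ ?_
  rw [idealOfVars, ← Set.image_univ, mem_ideal_span_X_image]
  intro m hm
  have hdeg := hp (mem_support_iff.mp hm)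
  by_contra! h
  have : m = 0 := Finsupp.ext fun i => h i trivial
  rw [this] at hdeg
  simp at hdeg
  lia

end SimpComplex

/-! ### The complex with facets `{0,1,2}`, `{2,3,4}`, `{3,4,5}` -/

/-- The facets of the Alexander dual of `exampleComplex`. -/
def dualFacets : Set (Finset (Fin 6)) := {{0, 1, 2}, {2, 3, 4}, {3, 4, 5}}

namespace SimpComplex

open MvPolynomial

universe u

variable {k : Type u} [Field k]

theorem forall_mem_dualFacets {P : Finset (Fin 6) → Prop} :
    (∀ F ∈ dualFacets, P F) ↔ P {0, 1, 2} ∧ P {2, 3, 4} ∧ P {3, 4, 5} := by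
  simp [dualFacets]

theorem mem_stanleyReisnerIdeal_dualFacets {p : MvPolynomial (Fin 6) k} :
    p ∈ (generatedBy dualFacets).stanleyReisnerIdeal k ↔
      restrictVars k {0, 1, 2} p = 0 ∧ restrictVars k {2, 3, 4} p = 0 ∧
        restrictVars k {3, 4, 5} p = 0 := by
  rw [mem_stanleyReisnerIdeal_generatedBy, forall_mem_dualFacets]

/-- Each facet contains exactly one of 0 and 3, so on each facet the form restricts to a variable,
which cancels. -/
theorem mem_ideal_of_X_zero_add_X_three_mul_mem {p : MvPolynomial (Fin 6) k}
    (h : (X 0 + X 3) * p ∈ (generatedBy dualFacets).stanleyReisnerIdeal k) :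
    p ∈ (generatedBy dualFacets).stanleyReisnerIdeal k := by
  rw [mem_stanleyReisnerIdeal_dualFacets] at h ⊢
  simpa [X_ne_zero] using h

/-- If `X a * restrictVars F f = X b * restrictVars F g` with `a ≠ b` and `b ∈ F`, then the two
sides are multiples of `X a * X b`. -/
theorem exists_restrictVars_eq_X_mul {V : Type*} [DecidableEq V] {F : Finset V} {a b : V}
    (hab : a ≠ b) (hb : b ∈ F) {f g : MvPolynomial V k}
    (h : X a * restrictVars k F f = X b * restrictVars k F g) :
    ∃ q, restrictVars k F f = X b * restrictVars k F q ∧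
      restrictVars k F g = X a * restrictVars k F q := by
  have hdvd : (X b : MvPolynomial V k) ∣ X a * restrictVars k F f := ⟨_, h⟩
  obtain ⟨q, hq⟩ := ((X_prime (R := k) (i := b)).dvd_or_dvd hdvd).resolve_left fun h' =>
    hab (X_dvd_X.mp h').symm
  have hq' : restrictVars k F f = X b * restrictVars k F q := by
    have := congrArg (restrictVars k F) hq
    rwa [restrictVars_restrictVars, Finset.inter_self, map_mul, restrictVars_X, if_pos hb] at this
  refine ⟨q, hq', mul_left_cancel₀ (X_ne_zero b) ?_⟩
  rw [← h, hq']
  ring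

/-- Regularity of x₂ + x₅ modulo x₀ + x₃. On each facet the two forms restrict to distinct
variables, which gives a local quotient; the local quotients agree on overlaps and glue. -/
theorem exists_sub_mem_ideal_of_mul_sub_mul_mem {f g : MvPolynomial (Fin 6) k}
    (h : (X 2 + X 5) * f - (X 0 + X 3) * g ∈ (generatedBy dualFacets).stanleyReisnerIdeal k) :
    ∃ q, f - (X 0 + X 3) * q ∈ (generatedBy dualFacets).stanleyReisnerIdeal k := by
  simp_rw [mem_stanleyReisnerIdeal_dualFacets] at h ⊢
  obtain ⟨h₁, h₂, h₃⟩ := h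
  simp [sub_eq_zero] at h₁ h₂ h₃
  obtain ⟨q₁, hf₁, hg₁⟩ := exists_restrictVars_eq_X_mul (by decide) (by decide) h₁
  obtain ⟨q₂, hf₂, hg₂⟩ := exists_restrictVars_eq_X_mul (by decide) (by decide) h₂
  obtain ⟨q₃, hf₃, hg₃⟩ := exists_restrictVars_eq_X_mul (by decide) (by decide) h₃
  have i12 : ({0, 1, 2} ∩ {2, 3, 4} : Finset (Fin 6)) = {2} := by decide
  have i21 : ({2, 3, 4} ∩ {0, 1, 2} : Finset (Fin 6)) = {2} := by decide
  have i23 : ({2, 3, 4} ∩ {3, 4, 5} : Finset (Fin 6)) = {3, 4} := by decide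
  have i32 : ({3, 4, 5} ∩ {2, 3, 4} : Finset (Fin 6)) = {3, 4} := by decide
  have i13 : ({0, 1, 2} ∩ {3, 4, 5} : Finset (Fin 6)) = ∅ := by decide
  have i31 : ({3, 4, 5} ∩ {0, 1, 2} : Finset (Fin 6)) = ∅ := by decide
  have j1 : ({0, 1, 2} ∩ {2} : Finset (Fin 6)) = {2} := by decide
  have j2 : ({2, 3, 4} ∩ {2} : Finset (Fin 6)) = {2} := by decide

  have j3 : ({3, 4, 5} ∩ {2} : Finset (Fin 6)) = ∅ := by decide
  have l1 : ({0, 1, 2} ∩ {3, 4} : Finset (Fin 6)) = ∅ := by decide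
  have l2 : ({2, 3, 4} ∩ {3, 4} : Finset (Fin 6)) = {3, 4} := by decide
  have l3 : ({3, 4, 5} ∩ {3, 4} : Finset (Fin 6)) = {3, 4} := by decide
  -- On the overlap {2} compare via `g`, where both factors are x₂; on {3,4} compare via `f`, where
  -- both are x₃.
  have c12 : restrictVars k {2} q₁ = restrictVars k {2} q₂ := by
    have h₁ := congrArg (restrictVars k {2, 3, 4}) hg₁
    have h₂ := congrArg (restrictVars k {0, 1, 2}) hg₂
    simp only [map_mul, restrictVars_restrictVars, i12, i21, restrictVars_X] at h₁ h₂
    exact mul_left_cancel₀ (X_ne_zero 2) (h₁.symm.trans h₂)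
  have c23 : restrictVars k {3, 4} q₂ = restrictVars k {3, 4} q₃ := by
    have h₂ := congrArg (restrictVars k {3, 4, 5}) hf₂
    have h₃ := congrArg (restrictVars k {2, 3, 4}) hf₃
    simp only [map_mul, restrictVars_restrictVars, i23, i32, restrictVars_X] at h₂ h₃
    exact mul_left_cancel₀ (X_ne_zero 3) (h₂.symm.trans h₃)
  have c0 (F : Finset (Fin 6)) {p q : MvPolynomial (Fin 6) k}
      (h : restrictVars k F p = restrictVars k F q) :
      restrictVars k ∅ p = restrictVars k ∅ q := by
    simpa [restrictVars_restrictVars] using congrArg (restrictVars k ∅) h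
  have d12 := c0 _ c12
  have d23 := c0 _ c23
  -- Inclusion–exclusion; the terms of the empty overlap of 012 with 345 and of the triple overlap
  -- cancel.
  refine ⟨restrictVars k {0, 1, 2} q₁ + restrictVars k {2, 3, 4} q₂ + restrictVars k {3, 4, 5} q₃
    - restrictVars k {2} q₁ - restrictVars k {3, 4} q₂, ?_, ?_, ?_⟩
  · rw [map_sub, hf₁]
    simp [restrictVars_restrictVars, i12, i13, j1, l1, c12, d23]
    ring
  · rw [map_sub, hf₂]
    simp [restrictVars_restrictVars, i21, i23, j2, l2, c12, c23]
    ring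
  · rw [map_sub, hf₃]
    simp [restrictVars_restrictVars, i31, i32, j3, l3, c12, c23, d12]
    ring

theorem mk_X_mul_X_eq_zero {S : Set (Finset (Fin 6))} (i j : Fin 6) (hij : i ≠ j)
    (h : ∀ F ∈ S, i ∈ F → j ∉ F) :
    (Ideal.Quotient.mk ((generatedBy S).stanleyReisnerIdeal k) (X i)) *
      Ideal.Quotient.mk ((generatedBy S).stanleyReisnerIdeal k) (X j) = 0 := by
  rw [← map_mul, Ideal.Quotient.eq_zero_iff_mem]
  refine Ideal.subset_span ⟨{i, j}, ?_, by simp [hij]⟩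
  rintro ⟨F, hF, hijF⟩
  exact h F hF (hijF (by simp)) (hijF (by simp))

/-- `x₀` does not lie in the ideal of the Stanley–Reisner ring generated by `x₀ + x₃` and `x₂ + x₅`. -/
theorem mk_X_zero_ne (f g : (generatedBy dualFacets).StanleyReisnerRing k) :
    Ideal.Quotient.mk ((generatedBy dualFacets).stanleyReisnerIdeal k) (X 0) ≠
      Ideal.Quotient.mk _ (X 0 + X 3) * f + Ideal.Quotient.mk _ (X 2 + X 5) * g := by
  -- ψ kills both linear forms but sends x₀ to ε ≠ 0. It descends to the ring because the only
  -- non-face inside {0,3} is {0,3}, and ε² = 0.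
  let ψ : MvPolynomial (Fin 6) k →ₐ[k] DualNumber k :=
    aeval fun i => if i = 0 then DualNumber.eps else if i = 3 then -DualNumber.eps else 0
  have hψ (p) (hp : p ∈ (generatedBy dualFacets).stanleyReisnerIdeal k) : ψ p = 0 := by
    suffices (generatedBy dualFacets).stanleyReisnerIdeal k ≤ RingHom.ker ψ from this hp
    refine Ideal.span_le.mpr ?_
    rintro _ ⟨G, hG, rfl⟩
    rw [SetLike.mem_coe, RingHom.mem_ker, map_prod]
    by_cases h : G ⊆ {0, 3}
    · have : G = {0, 3} := by
        have hG' : ¬ (G ⊆ {0, 1, 2} ∨ G ⊆ {2, 3, 4}) := fun h => hG <| by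
          rcases h with h | h
          · exact ⟨_, by simp [dualFacets], h⟩
          · exact ⟨_, by simp [dualFacets], h⟩
        clear hG
        revert G
        decide
      simp [this, ψ]
    · obtain ⟨i, hiG, hi⟩ := Finset.not_subset.mp h
      refine Finset.prod_eq_zero hiG ?_
      simp only [Finset.mem_insert, Finset.mem_singleton, not_or] at hi
      simp [ψ, hi.1, hi.2]
  intro h
  have h' := congrArg (Ideal.Quotient.lift _ ψ.toRingHom hψ) h
  simp [ψ] at h'
  simpa using congrArg TrivSqZeroExt.snd h'

theorem not_extVanishesBelow_three :
    ¬ ExtVanishesBelow (R := (generatedBy dualFacets).StanleyReisnerRing k)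
      ((generatedBy dualFacets).StanleyReisnerRing k ⧸ (idealOfVars (Fin 6) k).map
        (Ideal.Quotient.mk ((generatedBy dualFacets).stanleyReisnerIdeal k)))
      ((generatedBy dualFacets).StanleyReisnerRing k) 3 := by
  intro h
  let π := Ideal.Quotient.mk ((generatedBy dualFacets).stanleyReisnerIdeal k)
  suffices π (X 0) ∈ Ideal.span {π (X 0 + X 3), π (X 2 + X 5)} by
    obtain ⟨f, g, hfg⟩ := Ideal.mem_span_pair.mp this
    exact mk_X_zero_ne f g (by rw [mul_comm _ f, mul_comm _ g]; exact hfg.symm)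
  refine h.mem_span_pair ?_ ?_ fun r hr => ?_
  · intro x hx
    obtain ⟨p, rfl⟩ := Ideal.Quotient.mk_surjective x
    rw [← map_mul, Ideal.Quotient.eq_zero_iff_mem] at hx
    exact Ideal.Quotient.eq_zero_iff_mem.mpr (mem_ideal_of_X_zero_add_X_three_mul_mem hx)
  · intro x y hxy
    obtain ⟨f, rfl⟩ := Ideal.Quotient.mk_surjective x
    obtain ⟨g, rfl⟩ := Ideal.Quotient.mk_surjective y
    rw [← map_mul, ← map_mul, Ideal.Quotient.eq] at hxy
    obtain ⟨q, hq⟩ := exists_sub_mem_ideal_of_mul_sub_mul_mem hxy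
    exact ⟨π q, by rw [← map_mul]; exact Ideal.Quotient.eq.mpr hq⟩
  · suffices (idealOfVars (Fin 6) k).map π ≤ Submodule.comap
        (LinearMap.toSpanSingleton _ _ (π (X 0)))
        (Ideal.span {π (X 0 + X 3), π (X 2 + X 5)}) from this hr
    rw [idealOfVars, Ideal.map_span, Ideal.span_le]
    rintro _ ⟨_, ⟨i, rfl⟩, rfl⟩
    change π (X i) * π (X 0) ∈ Ideal.span {π (X 0 + X 3), π (X 2 + X 5)}
    have hz (i j : Fin 6) (hij : i ≠ j)
        (h : (i ∈ ({0, 1, 2} : Finset (Fin 6)) → j ∉ ({0, 1, 2} : Finset (Fin 6))) ∧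
          (i ∈ ({2, 3, 4} : Finset (Fin 6)) → j ∉ ({2, 3, 4} : Finset (Fin 6))) ∧
          (i ∈ ({3, 4, 5} : Finset (Fin 6)) → j ∉ ({3, 4, 5} : Finset (Fin 6)))) :
        π (X i) * π (X j) = 0 :=
      mk_X_mul_X_eq_zero i j hij (forall_mem_dualFacets.mpr h)
    -- These non-edges give x₀² = x₀(x₀ + x₃), x₁x₀ = x₁(x₀ + x₃), x₂x₀ = x₀(x₂ + x₅), and x₃x₀ =
    -- x₄x₀ = x₅x₀ = 0.
    have h03 := hz 0 3 (by decide) (by decide)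
    have h13 := hz 1 3 (by decide) (by decide)
    have h05 := hz 0 5 (by decide) (by decide)
    have h04 := hz 0 4 (by decide) (by decide)
    rw [Ideal.mem_span_pair]
    simp only [map_add]
    fin_cases i
    · exact ⟨π (X 0), 0, by simp only [Fin.mk_zero]; linear_combination h03⟩
    · exact ⟨π (X 1), 0, by simp only [Fin.mk_one]; linear_combination h13⟩
    · exact ⟨0, π (X 0), by simp only [Fin.reduceFinMk]; linear_combination h05⟩
    · exact ⟨0, 0, by simp only [Fin.reduceFinMk]; linear_combination - h03⟩
    · exact ⟨0, 0, by simp only [Fin.reduceFinMk]; linear_combination - h04⟩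
    · exact ⟨0, 0, by simp only [Fin.reduceFinMk]; linear_combination - h05⟩

/-! ### Failure of the Cohen–Macaulay properties -/

theorem annihilator_quotient_of_mem_grading {V : Type*} {Δ : SimpComplex V} (d : ℕ) (hd : 0 < d)
    (r : Δ.StanleyReisnerRing k) (hr : r ∈ Δ.stanleyReisnerGrading k d) :
    r ∈ Module.annihilator (Δ.StanleyReisnerRing k) (Δ.StanleyReisnerRing k ⧸
      (idealOfVars V k).map (Ideal.Quotient.mk (Δ.stanleyReisnerIdeal k))) := by
  rw [Ideal.annihilator_quotient]
  exact mem_map_idealOfVars_of_mem_grading hd hr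

theorem three_le_card_of_mem_dualFacets : ∀ F ∈ dualFacets, 3 ≤ F.card :=
  forall_mem_dualFacets.mpr (by decide)

theorem not_isSequentiallyCohenMacaulay_generatedBy_dualFacets :
    ¬ (generatedBy dualFacets).IsSequentiallyCohenMacaulay k := by
  intro h
  refine not_extVanishesBelow_three (k := k) ?_
  -- The vanishing is known for the submodule ⊤; the exact sequence ⊤ → R → 0 transfers it to R.
  refine (IsGradedSequentiallyCohenMacaulay.extVanishesBelow h
    (fun P hP => le_supportDim_of_ne_bot three_le_card_of_mem_dualFacets hP)
    annihilator_quotient_of_mem_grading).of_exact (f := Submodule.subtype _)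
    (g := (0 : _ →ₗ[_] PUnit.{u + 1})) (Submodule.injective_subtype _)
    (fun _ => ⟨0, rfl⟩) ?_ (.of_subsingleton 3)
  exact fun x => ⟨fun _ => ⟨⟨x, trivial⟩, rfl⟩, fun _ => rfl⟩

theorem not_isCohenMacaulay_generatedBy_dualFacets :
    ¬ (generatedBy dualFacets).IsCohenMacaulay k := by
  intro h
  refine not_extVanishesBelow_three (k := k) (IsGradedCohenMacaulay.extVanishesBelow h ?_
    annihilator_quotient_of_mem_grading)
  have : Nontrivial ((generatedBy dualFacets).StanleyReisnerRing k) :=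
    ⟨_, _, mk_X_zero_ne 0 0⟩
  rw [← Module.supportDim_eq_of_equiv (Submodule.topEquiv)]
  exact le_supportDim_of_ne_bot three_le_card_of_mem_dualFacets top_ne_bot

end SimpComplex

/-! ### Combinatorics of `exampleComplex` and its Alexander dual -/

namespace SimpComplex

variable {V : Type*}

theorem isMinimalNonface_avoiding {S : Set (Finset V)} (hS : IsAntichain (· ⊆ ·) S)
    {M : Finset V} : (avoiding S).IsMinimalNonface M ↔ M ∈ S := by
  have hnon (G : Finset V) : G ∉ (avoiding S).faces ↔ ∃ N ∈ S, N ⊆ G := by simp [avoiding]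
  simp only [IsMinimalNonface, hnon]
  constructor
  · rintro ⟨⟨N, hN, hNM⟩, hmin⟩
    rwa [(hmin ⟨N, hN, subset_rfl⟩ hNM).antisymm hNM]
  · refine fun hM => ⟨⟨M, hM, subset_rfl⟩, ?_⟩
    rintro G ⟨N, hN, hNG⟩ hGM
    exact hS.eq hN hM (hNG.trans hGM) ▸ hNG

theorem isFacet_generatedBy {S : Set (Finset V)} (hS : IsAntichain (· ⊆ ·) S)
    {F : Finset V} : (generatedBy S).IsFacet F ↔ F ∈ S := by
  constructor
  · rintro ⟨⟨G, hG, hFG⟩, hmax⟩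
    rwa [hFG.antisymm (hmax ⟨G, hG, subset_rfl⟩ hFG)]
  · refine fun hF => ⟨⟨F, hF, subset_rfl⟩, ?_⟩
    rintro G ⟨H, hH, hGH⟩ hFG
    exact hS.eq hF hH (hFG.trans hGH) ▸ hGH

/-- A complex on a finite vertex set is determined by its minimal non-faces. -/
theorem eq_avoiding_minimalNonfaces [Finite V] (Δ : SimpComplex V) :
    Δ = avoiding {M | Δ.IsMinimalNonface M} := by
  ext F
  constructor
  · exact fun hF M (hM : Δ.IsMinimalNonface M) hMF => hM.prop (Δ.down_closed hF hMF)
  · intro hF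
    by_contra h
    obtain ⟨M, hMF, hM⟩ := (Set.toFinite {G | G ∉ Δ.faces}).exists_le_minimal h
    exact hF M hM hMF

/-- By purity a facet of the intersection complex has one element fewer than `L[i]`, and it lies in
some earlier `L[j]`. -/
theorem IsShellingOrder.exists_lt_card_le_card_inter_add_one [DecidableEq V] {Δ : SimpComplex V}
    {L : List (Finset V)} (hL : Δ.IsShellingOrder L) (i : Fin L.length) (hi : 0 < i.val) :
    ∃ j < i, L[i].card ≤ (L[i] ∩ L[j]).card + 1 := by
  obtain ⟨hne, hpure⟩ := hL.2.2 i hi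
  have hfin : ((generatedBy {L[i]}).inter
      (generatedBy {F | ∃ j : Fin L.length, j < i ∧ L[j] = F})).faces.Finite := by
    refine (Finset.finite_toSet L[i].powerset).subset ?_
    rintro G ⟨⟨_, rfl, hG⟩, -⟩
    simpa using hG
  obtain ⟨G, hG⟩ := hfin.exists_maximal hne
  have hdim := hpure G hG
  obtain ⟨⟨_, rfl, hGi⟩, ⟨_, ⟨j, hj, rfl⟩, hGj⟩⟩ := hG.prop
  refine ⟨j, hj, ?_⟩
  have := Finset.card_le_card (Finset.subset_inter hGi hGj)
  simp only [faceDim] at hdim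
  lia

/-- A complex with at least two facets, one of which meets every other facet in codimension at
least two in both, is not shellable. -/
theorem not_isShellable_of_card_inter [DecidableEq V] {Δ : SimpComplex V} {F G : Finset V}
    (hF : Δ.IsFacet F) (hG : Δ.IsFacet G) (hGF : G ≠ F)
    (h : ∀ H, Δ.IsFacet H → H ≠ F →
      (F ∩ H).card + 1 < F.card ∧ (F ∩ H).card + 1 < H.card) : ¬ Δ.IsShellable := by
  rintro ⟨L, hL⟩
  obtain ⟨i, rfl⟩ := List.mem_iff_get.mp ((hL.2.1 F).mpr hF)
  obtain ⟨g, rfl⟩ := List.mem_iff_get.mp ((hL.2.1 G).mpr hG)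
  have hne {a b : Fin L.length} (hab : a ≠ b) : L.get a ≠ L.get b := fun e =>
    hab (hL.1.injective_get e)
  have hfacet (a : Fin L.length) : Δ.IsFacet (L.get a) := (hL.2.1 _).mp (L.get_mem a)
  -- If F comes first, the second facet has only F to attach to; otherwise F itself must attach to
  -- an earlier facet.
  rcases i.val.eq_zero_or_pos with hi | hi
  · have hgi : g ≠ i := fun e => hGF (by rw [e])
    have hlen : 1 < L.length := by
      have := Fin.val_ne_iff.mpr hgi
      lia
    obtain ⟨j, hj, hcard⟩ := hL.exists_lt_card_le_card_inter_add_one ⟨1, hlen⟩ one_pos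
    have hji : j = i := Fin.ext (by have : j.val < 1 := hj; lia)
    subst hji
    have := (h _ (hfacet ⟨1, hlen⟩) (hne hj.ne')).2
    rw [Finset.inter_comm] at this
    exact this.not_ge hcard
  · obtain ⟨j, hj, hcard⟩ := hL.exists_lt_card_le_card_inter_add_one i hi
    exact (h _ (hfacet j) (hne hj.ne)).1.not_ge hcard

/-! ### Shellability and a vertex link of the dual -/

theorem isAntichain_dualFacets : IsAntichain (· ⊆ ·) dualFacets :=
  Set.Sized.isAntichain (r := 3) (forall_mem_dualFacets.mpr (by decide))

theorem isFacet_generatedBy_dualFacets {F : Finset (Fin 6)} :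
    (generatedBy dualFacets).IsFacet F ↔ F ∈ dualFacets :=
  isFacet_generatedBy isAntichain_dualFacets

theorem not_isShellable_generatedBy_dualFacets : ¬ (generatedBy dualFacets).IsShellable := by
  refine not_isShellable_of_card_inter (F := {0, 1, 2}) (G := {2, 3, 4})
    (isFacet_generatedBy_dualFacets.mpr (by simp [dualFacets]))
    (isFacet_generatedBy_dualFacets.mpr (by simp [dualFacets])) (by decide) fun H hH => ?_
  revert H
  simp_rw [isFacet_generatedBy_dualFacets]
  exact forall_mem_dualFacets.mpr (by decide)

theorem mem_faces_generatedBy_dualFacets {F : Finset (Fin 6)} :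
    F ∈ (generatedBy dualFacets).faces ↔
      F ⊆ {0, 1, 2} ∨ F ⊆ {2, 3, 4} ∨ F ⊆ {3, 4, 5} := by
  simp [generatedBy, dualFacets]

theorem hasDim_link_generatedBy_dualFacets : ((generatedBy dualFacets).link {2}).HasDim 1 := by
  constructor
  · exact ⟨{0, 1}, ⟨by decide, mem_faces_generatedBy_dualFacets.mpr (by decide)⟩, rfl⟩
  · rintro _ ⟨G, ⟨hG, F, hF, hGF⟩, rfl⟩
    have hcard := Finset.card_le_card hGF
    rw [Finset.card_union_of_disjoint hG, Finset.card_singleton] at hcard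
    have := forall_mem_dualFacets (P := fun F => F.card ≤ 3) |>.mpr (by decide) F hF
    simp only [faceDim]
    lia

theorem not_isConnected_link_generatedBy_dualFacets :
    ¬ ((generatedBy dualFacets).link {2}).IsConnected := by
  intro h
  -- The link consists of the disjoint edges {0,1} and {3,4}; `u < 2` singles out the first and is
  -- preserved along walks.
  have hadj (u v : Fin 6) (huv : ({u, v} : Finset (Fin 6)) ∈
      ((generatedBy dualFacets).link {2}).faces) : u < 2 → v < 2 := by
    have h' := huv
    obtain ⟨hdisj, hface⟩ := h'
    rw [mem_faces_generatedBy_dualFacets] at hface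
    clear huv h
    revert u v
    decide
  have hmem (v : Fin 6) (hv : v = 0 ∨ v = 3) :
      ({v} : Finset (Fin 6)) ∈ ((generatedBy dualFacets).link {2}).faces := by
    refine ⟨?_, mem_faces_generatedBy_dualFacets.mpr ?_⟩ <;> revert v <;> decide
  obtain ⟨w⟩ := h.preconnected ⟨0, hmem 0 (by decide)⟩ ⟨3, hmem 3 (by decide)⟩
  have hwalk : ∀ {u v} (_ : ((generatedBy dualFacets).link {2}).edgeGraph.Walk u v),
      u.1 < 2 → v.1 < 2 := by
    intro u v w
    induction w with
    | nil => exact id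
    | cons huv _ ih => exact fun hu => ih (hadj _ _ huv.2 hu)
  exact absurd (hwalk w (show (0 : Fin 6) < 2 by decide)) (show ¬ (3 : Fin 6) < 2 by decide)

end SimpComplex

/-! ### The example and its dual -/

open SimpComplex

theorem mem_faces_exampleComplex {F : Finset (Fin 6)} :
    F ∈ exampleComplex.faces ↔
      ¬ {0, 1, 2} ⊆ F ∧ ¬ {0, 1, 5} ⊆ F ∧ ¬ {3, 4, 5} ⊆ F := by
  simp [exampleComplex, avoiding]

theorem alexanderDual_exampleComplex :
    exampleComplex.alexanderDual = generatedBy dualFacets := by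
  ext F
  change Fᶜ ∉ exampleComplex.faces ↔ _
  rw [mem_faces_exampleComplex, mem_faces_generatedBy_dualFacets]
  revert F
  decide

theorem noGhostVertices_exampleComplex : exampleComplex.NoGhostVertices := by
  intro v
  rw [mem_faces_exampleComplex]
  revert v
  decide

theorem isMinimalNonface_exampleComplex {M : Finset (Fin 6)} :
    exampleComplex.IsMinimalNonface M ↔
      M ∈ ({{0, 1, 2}, {0, 1, 5}, {3, 4, 5}} : Set (Finset (Fin 6))) := by
  refine isMinimalNonface_avoiding (Set.Sized.isAntichain (r := 3) ?_)
  rintro F (rfl | rfl | rfl) <;> rfl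

/-- The only disjoint pair is 012, 345, whose union is everything, and 015 stands after 012. -/
theorem isStrongGcdOrder_exampleComplex :
    exampleComplex.IsStrongGcdOrder [{0, 1, 2}, {0, 1, 5}, {3, 4, 5}] := by
  refine ⟨by decide, fun M => ?_, by decide⟩
  rw [isMinimalNonface_exampleComplex]
  simp

theorem mainTheorem6 :
    -- the minimal non-faces, and absence of ghost vertices; these minimal non-faces determine `Δ₁`
    exampleComplex.NoGhostVertices ∧
    {M | exampleComplex.IsMinimalNonface M} = {{0, 1, 2}, {0, 1, 5}, {3, 4, 5}} ∧
    (∀ Δ : SimpComplex (Fin 6),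
      {M | Δ.IsMinimalNonface M} = {{0, 1, 2}, {0, 1, 5}, {3, 4, 5}} → Δ = exampleComplex) ∧
    -- the listed order is a strong gcd-order
    exampleComplex.IsStrongGcdOrder [{0, 1, 2}, {0, 1, 5}, {3, 4, 5}] ∧
    -- the Alexander dual: its facets, and the link of the vertex `3`
    {F | exampleComplex.alexanderDual.IsFacet F} = {{0, 1, 2}, {2, 3, 4}, {3, 4, 5}} ∧
    (exampleComplex.alexanderDual.link {2}).HasDim 1 ∧
    ¬ (exampleComplex.alexanderDual.link {2}).IsConnected ∧
    -- over every field the dual is not Cohen–Macaulay, nor even sequentially Cohen–Macaulay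
    (∀ (k : Type*) [Field k], ¬ exampleComplex.alexanderDual.IsCohenMacaulay k) ∧
    (∀ (k : Type*) [Field k], ¬ exampleComplex.alexanderDual.IsSequentiallyCohenMacaulay k) ∧
    -- and the dual is not shellable
    ¬ exampleComplex.alexanderDual.IsShellable ∧
    -- hence the strong gcd-condition implies neither property of the dual
    (∀ (k : Type*) [Field k],
      ¬ ∀ (V : Type) [Fintype V] [DecidableEq V] (Δ : SimpComplex V),
        Δ.NoGhostVertices → Δ.StrongGcd → Δ.alexanderDual.IsSequentiallyCohenMacaulay k) ∧
    (¬ ∀ (V : Type) [Fintype V] [DecidableEq V] (Δ : SimpComplex V),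
        Δ.NoGhostVertices → Δ.StrongGcd → Δ.alexanderDual.IsShellable) := by
  simp_rw [alexanderDual_exampleComplex]
  refine ⟨noGhostVertices_exampleComplex, Set.ext fun _ => isMinimalNonface_exampleComplex,
    fun Δ hΔ => ?_, isStrongGcdOrder_exampleComplex,
    Set.ext fun _ => isFacet_generatedBy_dualFacets, hasDim_link_generatedBy_dualFacets,
    not_isConnected_link_generatedBy_dualFacets,
    fun _ _ => not_isCohenMacaulay_generatedBy_dualFacets,
    fun _ _ => not_isSequentiallyCohenMacaulay_generatedBy_dualFacets,
    not_isShellable_generatedBy_dualFacets, fun k _ h => ?_, fun h => ?_⟩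
  · rw [Δ.eq_avoiding_minimalNonfaces, hΔ, exampleComplex]
  · exact not_isSequentiallyCohenMacaulay_generatedBy_dualFacets (k := k) <|
      alexanderDual_exampleComplex ▸ h _ exampleComplex noGhostVertices_exampleComplex
        ⟨_, isStrongGcdOrder_exampleComplex⟩
  · exact not_isShellable_generatedBy_dualFacets <|
      alexanderDual_exampleComplex ▸ h _ exampleComplex noGhostVertices_exampleComplex
        ⟨_, isStrongGcdOrder_exampleComplex⟩
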